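/- Setting. Let $\Theta\subseteq\mathbb R^n$ be a connected open set and let $\{\rho_\theta\}_{\theta\in\Theta}$ be a family of full-rank quantum states on $\mathbb C^d$ (positive-definite $d\times d$ complex matrices of trace one). Assume that the model is regular: $\theta\mapsto\rho_\theta$ is smooth and one-to-one, and at every $\theta\in\Theta$ the partial derivatives $\partial_1\rho_\theta,\dots,\partial_n\rho_\theta$ are linearly independent and the eigenvalues of $\rho_\theta$ are non-degenerate (pairwise distinct). Notation. For operators $X,Y$ put $\langle X,Y\rangle_{\rho}=\frac12\mathrm{tr}\,\rho(YX^\dagger+X^\dagger Y)$ and $\langle X,Y\rangle^{+}_{\rho}=\mathrm{tr}\,\rho YX^\dagger$. The SLD operators $L_{\theta,i}$, the RLD operators $\tilde L_{\theta,i}$ and the commutation operator $\mathcal D_{\rho_\theta}$ are the unique solutions of $$\partial_i\rho_\theta=\tfrac12(\rho_\theta L_{\theta,i}+L_{\theta,i}\rho_\theta),\qquad \partial_i\rho_\theta=\rho_\theta\tilde L_{\theta,i},\qquad [\rho_\theta,X]=\mathrm i\,\rho_\theta\mathcal D_{\rho_\theta}(X)+\mathrm i\,\mathcal D_{\rho_\theta}(X)\rho_\theta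 .$$ Let $T_\theta=\mathrm{span}_{\mathbb R}\{L_{\theta,i}\}$ and $\tilde T_\theta=\mathrm{span}_{\mathbb C}\{\tilde L_{\theta,i}\}$ be the SLD and RLD tangent spaces, and $G_\theta=[\langle L_{\theta,i},L_{\theta,j}\rangle_{\rho_\theta}]$, $\tilde G_\theta=[\langle\tilde L_{\theta,i},\tilde L_{\theta,j}\rangle^{+}_{\rho_\theta}]$ the SLD and RLD Fisher information matrices. For a real positive-definite $n\times n$ matrix $W$ let $C^S_\theta[W]=\mathrm{Tr}\,(WG_\theta^{-1})$ be the SLD Cramér–Rao bound, and let $$C^H_\theta[W]=\inf_{\vec X}\Big(\mathrm{Tr}\,(W\,\mathrm{Re}\,H_\theta[\vec X])+\mathrm{Tr}\,\big|W^{1/2}\,\mathrm{Im}\,H_\theta[\vec X]\,W^{1/2}\big|\Big),\qquad H_\theta[\vec X]=[\langle X^i,X^j\rangle^{+}_{\rho_\theta}],$$ be the Holevo bound, where $|A|=\sqrt{A^\dagger A}$, real and imaginary parts are taken entrywise, and the infimum is over all $n$-tuples $\vec X=(X^1,\dots,X^n)$ of Hermitian operators with $\mathrm{tr}(\rho_\theta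 X^i)=0$ and $\mathrm{tr}(\partial_i\rho_\theta X^j)=\delta_{ij}$ for all $i,j$. The model is *D-invariant* if $\mathcal D_{\rho_\theta}(T_\theta)\subseteq T_\theta$ for all $\theta\in\Theta$, and *asymptotically classical* if $C^H_\theta[W]=C^S_\theta[W]$ for all $\theta\in\Theta$ and all real positive-definite $W$. Theorem. The following conditions are equivalent: 1. the model is classical: there is a unitary $U$, independent of $\theta$, such that $U^{-1}\rho_\theta U$ is diagonal for all $\theta\in\Theta$; 2. $[X,\rho_\theta]=0$ for all $\theta\in\Theta$ and all $X\in T_\theta$; 3. $[X,\rho_\theta]=0$ for all $\theta\in\Theta$ and all $X\in\tilde T_\theta$; 4. $G_\theta=\tilde G_\theta$ for all $\theta\in\Theta$; 5. $L_{\theta,i}=\tilde L_{\theta,i}$ for all $\theta\in\Theta$ and all $i$; 6. $\mathcal D_{\rho_\theta}(X)=0$ for all $\theta\in\Theta$ and all $X\in T_\theta$; 7. $\mathcal D_{\rho_\theta}(X)=0$ for all $\theta\in\Theta$ and all $X\in\tilde T_\theta$; 8. the model is both D-invariant and asymptotically classical. In particular, the model is classical if and only if it is both D-invariant and asymptotically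 classical. -/

import Mathlib

open scoped ContDiff ComplexOrder MatrixOrder Matrix

noncomputable section

/-! ### Operators attached to a full-rank state -/

namespace QuantumState

variable {d : ℕ}

/-- The SLD (symmetric logarithmic derivative) inner product
`⟨X, Y⟩ = (1/2) tr (ρ (Y X† + X† Y))` at the state `ρ`. -/
def sldInner (ρ X Y : Matrix (Fin d) (Fin d) ℂ) : ℂ :=
  (1 / 2 : ℂ) * (ρ * (Y * Xᴴ + Xᴴ * Y)).trace

/-- The RLD (right logarithmic derivative) inner product `⟨X, Y⟩ = tr (ρ Y X†)`
at the state `ρ`. -/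
def rldInner (ρ X Y : Matrix (Fin d) (Fin d) ℂ) : ℂ :=
  (ρ * Y * Xᴴ).trace

/-- The anticommutator map `X ↦ ρ X + X ρ` on operators. -/
def anticomm (ρ : Matrix (Fin d) (Fin d) ℂ) : Module.End ℂ (Matrix (Fin d) (Fin d) ℂ) :=
  LinearMap.mulLeft ℂ ρ + LinearMap.mulRight ℂ ρ

/-- The commutator map `X ↦ [ρ, X] = ρ X - X ρ` on operators. -/
def comm (ρ : Matrix (Fin d) (Fin d) ℂ) : Module.End ℂ (Matrix (Fin d) (Fin d) ℂ) :=
  LinearMap.mulLeft ℂ ρ - LinearMap.mulRight ℂ ρ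

/-- The solution `L` of `A = (1/2) (ρ L + L ρ)`, for a full-rank state `ρ`
(see `sldOp_spec` and `sldOp_unique`). -/
def sldOp (ρ A : Matrix (Fin d) (Fin d) ℂ) : Matrix (Fin d) (Fin d) ℂ :=
  Ring.inverse (anticomm ρ) ((2 : ℂ) • A)

/-- The solution `L` of `A = ρ L`, for a full-rank state `ρ`
(see `rldOp_spec` and `rldOp_unique`). -/
def rldOp (ρ A : Matrix (Fin d) (Fin d) ℂ) : Matrix (Fin d) (Fin d) ℂ :=
  ρ⁻¹ * A

/-- The commutation operator `D` of the full-rank state `ρ`: `D X` is the solution of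
`[ρ, X] = i ρ (D X) + i (D X) ρ` (see `commOp_spec` and `commOp_unique`). -/
def commOp (ρ : Matrix (Fin d) (Fin d) ℂ) : Module.End ℂ (Matrix (Fin d) (Fin d) ℂ) :=
  (-Complex.I) • (Ring.inverse (anticomm ρ) * comm ρ)

lemma anticomm_injective {ρ : Matrix (Fin d) (Fin d) ℂ} (hρ : ρ.PosDef) :
    Function.Injective (anticomm ρ) := by
  rw [injective_iff_map_eq_zero]
  intro X hX
  have hX' : ρ * X + X * ρ = 0 := hX
  have h1 : (Xᴴ * ρ * X).PosSemidef := hρ.posSemidef.conjTranspose_mul_mul_same X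
  have h2 : (X * ρ * Xᴴ).PosSemidef := hρ.posSemidef.mul_mul_conjTranspose_same X
  have h3 : (Xᴴ * ρ * X).trace + (X * ρ * Xᴴ).trace = 0 := by
    rw [Matrix.trace_mul_comm (X * ρ) Xᴴ, ← Matrix.trace_add, Matrix.mul_assoc,
      ← Matrix.mul_add, hX', Matrix.mul_zero, Matrix.trace_zero]
  have h4 : (Xᴴ * ρ * X).trace = 0 :=
    le_antisymm (by rw [eq_neg_of_add_eq_zero_left h3]; exact neg_nonpos.2 h2.trace_nonneg)
      h1.trace_nonneg
  have h5 : Xᴴ * ρ * X = 0 := h1.trace_eq_zero_iff.1 h4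
  by_contra hne
  have : ∃ v, X *ᵥ v ≠ 0 := by
    by_contra! hv
    exact hne (Matrix.ext_of_mulVec_single fun i => by rw [hv, Matrix.zero_mulVec])
  obtain ⟨v, hv⟩ := this
  have h6 := hρ.dotProduct_mulVec_pos hv
  have h7 : star (X *ᵥ v) ⬝ᵥ ρ *ᵥ (X *ᵥ v) = star v ⬝ᵥ (Xᴴ * ρ * X) *ᵥ v := by
    rw [Matrix.star_mulVec, ← Matrix.dotProduct_mulVec, Matrix.mulVec_mulVec,
      Matrix.mulVec_mulVec, Matrix.mul_assoc]
  rw [h7, h5] at h6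
  simp at h6

lemma isUnit_anticomm {ρ : Matrix (Fin d) (Fin d) ℂ} (hρ : ρ.PosDef) : IsUnit (anticomm ρ) :=
  (Module.End.isUnit_iff _).2
    ⟨anticomm_injective hρ, LinearMap.injective_iff_surjective.1 (anticomm_injective hρ)⟩

lemma anticomm_inverse {ρ : Matrix (Fin d) (Fin d) ℂ} (hρ : ρ.PosDef)
    (A : Matrix (Fin d) (Fin d) ℂ) :
    ρ * Ring.inverse (anticomm ρ) A + Ring.inverse (anticomm ρ) A * ρ = A := by
  have h := Ring.mul_inverse_cancel _ (isUnit_anticomm hρ)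
  exact congrArg (fun f : Module.End ℂ (Matrix (Fin d) (Fin d) ℂ) => f A) h

lemma sldOp_spec {ρ : Matrix (Fin d) (Fin d) ℂ} (hρ : ρ.PosDef)
    (A : Matrix (Fin d) (Fin d) ℂ) :
    A = (1 / 2 : ℂ) • (ρ * sldOp ρ A + sldOp ρ A * ρ) := by
  rw [sldOp, anticomm_inverse hρ, smul_smul]
  norm_num

lemma sldOp_unique {ρ : Matrix (Fin d) (Fin d) ℂ} (hρ : ρ.PosDef)
    {A L : Matrix (Fin d) (Fin d) ℂ} (hL : A = (1 / 2 : ℂ) • (ρ * L + L * ρ)) :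
    L = sldOp ρ A := by
  apply anticomm_injective hρ
  change ρ * L + L * ρ = ρ * sldOp ρ A + sldOp ρ A * ρ
  rw [sldOp, anticomm_inverse hρ, hL, smul_smul]
  norm_num

lemma rldOp_spec {ρ : Matrix (Fin d) (Fin d) ℂ} (hρ : ρ.PosDef)
    (A : Matrix (Fin d) (Fin d) ℂ) : A = ρ * rldOp ρ A := by
  rw [rldOp, Matrix.mul_nonsing_inv_cancel_left _ _ ((Matrix.isUnit_iff_isUnit_det _).1 hρ.isUnit)]

lemma rldOp_unique {ρ : Matrix (Fin d) (Fin d) ℂ} (hρ : ρ.PosDef)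
    {A L : Matrix (Fin d) (Fin d) ℂ} (hL : A = ρ * L) : L = rldOp ρ A := by
  rw [rldOp, hL,
    Matrix.nonsing_inv_mul_cancel_left _ _ ((Matrix.isUnit_iff_isUnit_det _).1 hρ.isUnit)]

lemma commOp_spec {ρ : Matrix (Fin d) (Fin d) ℂ} (hρ : ρ.PosDef)
    (X : Matrix (Fin d) (Fin d) ℂ) :
    ρ * X - X * ρ = Complex.I • (ρ * commOp ρ X) + Complex.I • (commOp ρ X * ρ) := by
  have h := anticomm_inverse hρ (ρ * X - X * ρ)
  have hD : commOp ρ X = (-Complex.I) • Ring.inverse (anticomm ρ) (ρ * X - X * ρ) := rfl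
  rw [← smul_add, hD, Matrix.mul_smul, Matrix.smul_mul, ← smul_add, h, smul_smul]
  simp

lemma commOp_unique {ρ : Matrix (Fin d) (Fin d) ℂ} (hρ : ρ.PosDef)
    {X Y : Matrix (Fin d) (Fin d) ℂ}
    (hY : ρ * X - X * ρ = Complex.I • (ρ * Y) + Complex.I • (Y * ρ)) : Y = commOp ρ X := by
  apply anticomm_injective hρ
  have h := hY.symm.trans (commOp_spec hρ X)
  rw [← smul_add, ← smul_add] at h
  exact smul_right_injective _ Complex.I_ne_zero h

end QuantumState

/-- An `n`-parameter quantum statistical model on a `d`-dimensional quantum system (operators on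
the Hilbert space being `d × d` complex matrices): an open parameter set `Θ ⊆ ℝⁿ` and, for each
`θ ∈ Θ`, a full-rank state `ρ θ`. Values of `ρ` outside `Θ` are irrelevant. -/
structure QuantumModel (n d : ℕ) where
  /-- the parameter set -/
  Θ : Set (Fin n → ℝ)
  isOpen : IsOpen Θ
  /-- the family of states -/
  ρ : (Fin n → ℝ) → Matrix (Fin d) (Fin d) ℂ
  posDef : ∀ θ ∈ Θ, (ρ θ).PosDef
  trace_one : ∀ θ ∈ Θ, (ρ θ).trace = 1

namespace QuantumModel

open QuantumState

variable {n d : ℕ} (M : QuantumModel n d)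

/-- The partial derivative `∂ᵢ ρ_θ`, taken entrywise. -/
def partialDeriv (θ : Fin n → ℝ) (i : Fin n) : Matrix (Fin d) (Fin d) ℂ :=
  Matrix.of fun a b => fderiv ℝ (fun θ' => M.ρ θ' a b) θ (Pi.single i 1)

/-- The regularity conditions: `θ ↦ ρ_θ` is smooth and one-to-one on `Θ`, and at every point of
`Θ` the partial derivatives are linearly independent and the eigenvalues of `ρ_θ` are
non-degenerate. -/
structure IsRegular : Prop where
  smooth : ∀ a b, ContDiffOn ℝ ∞ (fun θ => M.ρ θ a b) M.Θ
  injOn : Set.InjOn M.ρ M.Θ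
  linearIndependent : ∀ θ ∈ M.Θ, LinearIndependent ℝ (M.partialDeriv θ)
  nondegenerate : ∀ θ (hθ : θ ∈ M.Θ), Function.Injective (M.posDef θ hθ).isHermitian.eigenvalues

/-- The `i`-th SLD operator `L_{θ,i}`: the solution of `∂ᵢ ρ = (1/2) (ρ L + L ρ)`. -/
def sld (θ : Fin n → ℝ) (i : Fin n) : Matrix (Fin d) (Fin d) ℂ :=
  sldOp (M.ρ θ) (M.partialDeriv θ i)

/-- The `i`-th RLD operator `L̃_{θ,i}`: the solution of `∂ᵢ ρ = ρ L̃`. -/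
def rld (θ : Fin n → ℝ) (i : Fin n) : Matrix (Fin d) (Fin d) ℂ :=
  rldOp (M.ρ θ) (M.partialDeriv θ i)

/-- The SLD Fisher information matrix `G_θ`. -/
def sldFisher (θ : Fin n → ℝ) : Matrix (Fin n) (Fin n) ℂ :=
  Matrix.of fun i j => sldInner (M.ρ θ) (M.sld θ i) (M.sld θ j)

/-- The RLD Fisher information matrix `G̃_θ`. -/
def rldFisher (θ : Fin n → ℝ) : Matrix (Fin n) (Fin n) ℂ :=
  Matrix.of fun i j => rldInner (M.ρ θ) (M.rld θ i) (M.rld θ j)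

/-- The SLD tangent space: the real span of the SLD operators. -/
def sldTangent (θ : Fin n → ℝ) : Submodule ℝ (Matrix (Fin d) (Fin d) ℂ) :=
  Submodule.span ℝ (Set.range (M.sld θ))

/-- The RLD tangent space: the complex span of the RLD operators. -/
def rldTangent (θ : Fin n → ℝ) : Submodule ℂ (Matrix (Fin d) (Fin d) ℂ) :=
  Submodule.span ℂ (Set.range (M.rld θ))

/-- The model is classical: one `θ`-independent unitary diagonalizes every `ρ_θ`. -/
def IsClassical : Prop :=
  ∃ U ∈ Matrix.unitaryGroup (Fin d) ℂ, ∀ θ ∈ M.Θ, ∃ p : Fin d → ℝ,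
    M.ρ θ = U * Matrix.diagonal (fun k => (p k : ℂ)) * U⁻¹

/-- The model is (globally) D-invariant: at every `θ` the SLD tangent space is invariant under
the commutation operator. -/
def IsDInvariant : Prop :=
  ∀ θ ∈ M.Θ, ∀ X ∈ M.sldTangent θ, commOp (M.ρ θ) X ∈ M.sldTangent θ

/-- The admissible families `X = (X¹, …, Xⁿ)` in the Holevo bound: Hermitian operators with
`tr (ρ_θ Xⁱ) = 0` and `tr (∂ᵢ ρ_θ Xʲ) = δᵢⱼ`. -/
def holevoSet (θ : Fin n → ℝ) : Set (Fin n → Matrix (Fin d) (Fin d) ℂ) :=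
  {X | (∀ i, (X i).IsHermitian) ∧ (∀ i, (M.ρ θ * X i).trace = 0) ∧
    ∀ i j, (M.partialDeriv θ i * X j).trace = if i = j then 1 else 0}

/-- The Hermitian matrix `H_θ[X]` with entries the RLD inner products `⟨Xⁱ, Xʲ⟩`. -/
def holevoMatrix (θ : Fin n → ℝ) (X : Fin n → Matrix (Fin d) (Fin d) ℂ) :
    Matrix (Fin n) (Fin n) ℂ :=
  Matrix.of fun i j => rldInner (M.ρ θ) (X i) (X j)

/-- The Holevo function
`h_θ[X | W] = Tr (W Re H_θ[X]) + Tr |W^(1/2) (Im H_θ[X]) W^(1/2)|`, where real and imaginary parts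
are entrywise and `|A| = (A† A)^(1/2)`. -/
def holevoFun (θ : Fin n → ℝ) (X : Fin n → Matrix (Fin d) (Fin d) ℂ)
    (W : Matrix (Fin n) (Fin n) ℝ) : ℝ :=
  (W * (M.holevoMatrix θ X).map Complex.re).trace +
    (CFC.abs (CFC.sqrt W * (M.holevoMatrix θ X).map Complex.im * CFC.sqrt W)).trace

/-- The Holevo bound `C_θ^H[W]`, the infimum of the Holevo function over the admissible
families. -/
def holevoBound (θ : Fin n → ℝ) (W : Matrix (Fin n) (Fin n) ℝ) : ℝ :=
  sInf ((fun X => M.holevoFun θ X W) '' M.holevoSet θ)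

/-- The SLD Cramér-Rao bound `C_θ^S[W] = Tr (W G_θ⁻¹)`; the matrix `G_θ` has real entries. -/
def sldBound (θ : Fin n → ℝ) (W : Matrix (Fin n) (Fin n) ℝ) : ℝ :=
  (W * ((M.sldFisher θ)⁻¹).map Complex.re).trace

/-- The model is (globally) asymptotically classical: at every `θ` the Holevo bound equals the
SLD Cramér-Rao bound for all positive-definite weight matrices. -/
def IsAsymptoticallyClassical : Prop :=
  ∀ θ ∈ M.Θ, ∀ W : Matrix (Fin n) (Fin n) ℝ, W.PosDef → M.holevoBound θ W = M.sldBound θ W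

end QuantumModel

end

/-!
Every condition says the same thing: at each `θ` the derivatives `∂ᵢρ` commute with `ρ`.

For the conditions on the logarithmic derivatives this is algebra at one point. If `∂ᵢρ` commutes
with `ρ`, then `ρ⁻¹ ∂ᵢρ` solves the SLD equation, so the SLD and the RLD agree and commute with `ρ`;
the converses are read off the defining equations, and `D X = 0` means `[ρ, X] = 0`. For the Fisher
matrices, the difference of the `i`-th diagonal entries of the RLD and the SLD matrix is the squared
norm of `L̃ᵢ - Lᵢ` (`QuantumState.rldInner_sub_sldInner_self`).

Classicality means that the states commute pairwise, since the spectra are simple. Pairwise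
commutativity gives `[∂ᵢρ, ρ] = 0` by differentiation. Conversely, in a basis that diagonalizes
`ρ_θ`, the relation `[∂ᵢρ, ρ] = 0` bounds the off-diagonal part of the derivative of `ρ` by a
multiple of the off-diagonal part of `ρ`, because the diagonal entries stay separated near `θ`.
Grönwall's lemma then makes the off-diagonal part vanish near `θ`
(`eventually_offDiagonal_eq_zero`), so nearby states commute. As commuting with a state of simple
spectrum is transitive, connectedness of `Θ` makes all states commute.

For the Holevo bound, let `X⁰ᵢ = ∑ⱼ (G⁻¹)ᵢⱼ Lⱼ`, an admissible family with `Re H[X⁰] = G⁻¹`. Any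
admissible `X` is `X⁰ + Z` with `Z` orthogonal to the SLD tangent space `T`, and
`Re H[X] = G⁻¹ + Re H[Z]`. Hence the SLD bound is a lower bound of the Holevo function, attained
when `H[X⁰]` is real, as it is when `D` vanishes on `T`. If `T` is D-invariant, then the imaginary
parts also add up. As `|Im H[Z]ᵢⱼ| ≤ Tr Re H[Z]`, for the weight `1` the Holevo function exceeds
the SLD bound by at least `|Im H[X⁰]ᵢⱼ|` (`QuantumModel.IsRegular.sldBound_add_abs_le_holevoFun`).
So equality of the bounds makes the RLD inner product real on `T`, and then
`⟨DY, DY⟩ = -Im ⟨Y, DY⟩ = 0` for `Y ∈ T`.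
-/

/-! ### Logarithmic derivatives and the commutation operator at one state -/

namespace QuantumState

variable {d : ℕ} {ρ A L X : Matrix (Fin d) (Fin d) ℂ}

lemma commOp_eq_zero_iff (hρ : ρ.PosDef) : commOp ρ X = 0 ↔ Commute X ρ := by
  refine ⟨fun h => ?_, fun h => ?_⟩
  · have h1 := commOp_spec hρ X
    rw [h] at h1
    exact (sub_eq_zero.1 (by simpa using h1)).symm
  · refine (commOp_unique hρ ?_).symm
    simp [h.eq]

lemma sldOp_eq_rldOp_of_commute (hρ : ρ.PosDef) (h : Commute A ρ) : sldOp ρ A = rldOp ρ A := by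
  have hu : IsUnit ρ.det := (Matrix.isUnit_iff_isUnit_det _).1 hρ.isUnit
  refine (sldOp_unique hρ ?_).symm
  rw [← rldOp_spec hρ, rldOp, Matrix.mul_assoc, h.eq, Matrix.nonsing_inv_mul_cancel_left _ _ hu]
  module

lemma commute_rldOp_iff (hρ : ρ.PosDef) : Commute (rldOp ρ A) ρ ↔ Commute A ρ := by
  refine ⟨fun h => ?_, fun h => ?_⟩
  · rw [rldOp_spec hρ A]
    exact (Commute.refl ρ).mul_left h
  · have hu : IsUnit ρ.det := (Matrix.isUnit_iff_isUnit_det _).1 hρ.isUnit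
    change ρ⁻¹ * A * ρ = ρ * (ρ⁻¹ * A)
    rw [Matrix.mul_assoc, h.eq, Matrix.nonsing_inv_mul_cancel_left _ _ hu,
      Matrix.mul_nonsing_inv_cancel_left _ _ hu]

lemma commute_sldOp_iff (hρ : ρ.PosDef) : Commute (sldOp ρ A) ρ ↔ Commute A ρ := by
  refine ⟨fun h => ?_, fun h => ?_⟩
  · rw [sldOp_spec hρ A]
    exact (((Commute.refl ρ).mul_left h).add_left (h.mul_left (Commute.refl ρ))).smul_left _
  · rw [sldOp_eq_rldOp_of_commute hρ h]
    exact (commute_rldOp_iff hρ).2 h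

lemma sldOp_eq_rldOp_iff (hρ : ρ.PosDef) : sldOp ρ A = rldOp ρ A ↔ Commute A ρ := by
  refine ⟨fun h => ?_, sldOp_eq_rldOp_of_commute hρ⟩
  have h1 := sldOp_spec hρ A
  have h2 := rldOp_spec hρ A
  rw [← h] at h2
  rw [← commute_sldOp_iff hρ]
  have h3 : A + A = ρ * sldOp ρ A + sldOp ρ A * ρ := by
    conv_lhs => rw [h1]
    module
  rw [← h2] at h3
  exact ((add_left_cancel h3).symm.trans h2)

lemma sldOp_isHermitian (hρ : ρ.PosDef) (hA : A.IsHermitian) : (sldOp ρ A).IsHermitian := by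
  refine sldOp_unique hρ ?_
  have h := congrArg Matrix.conjTranspose (sldOp_spec hρ A)
  rw [hA.eq, Matrix.conjTranspose_smul, Matrix.conjTranspose_add, Matrix.conjTranspose_mul,
    Matrix.conjTranspose_mul, hρ.isHermitian.eq, add_comm] at h
  simpa using h

/-- The defining equation of the SLD, tested against an operator. -/
lemma trace_mul_eq_sldOp (hρ : ρ.PosDef) (A X : Matrix (Fin d) (Fin d) ℂ) :
    (A * X).trace =
      (1 / 2 : ℂ) * ((ρ * sldOp ρ A * X).trace + (ρ * X * sldOp ρ A).trace) := by
  conv_lhs => rw [sldOp_spec hρ A]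
  rw [Matrix.smul_mul, Matrix.trace_smul, Matrix.add_mul, Matrix.trace_add, smul_eq_mul,
    ← Matrix.trace_mul_cycle ρ X (sldOp ρ A)]

lemma trace_mul_sldOp (hρ : ρ.PosDef) (A : Matrix (Fin d) (Fin d) ℂ) :
    (ρ * sldOp ρ A).trace = A.trace := by
  have h := trace_mul_eq_sldOp hρ A 1
  simp only [Matrix.mul_one] at h
  rw [h]; ring

lemma rldInner_self_nonneg (hρ : ρ.PosDef) (X : Matrix (Fin d) (Fin d) ℂ) :
    0 ≤ rldInner ρ X X := by
  rw [rldInner, Matrix.trace_mul_comm, ← Matrix.mul_assoc]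
  exact (hρ.posSemidef.conjTranspose_mul_mul_same X).trace_nonneg

lemma rldInner_self_eq_zero (hρ : ρ.PosDef) : rldInner ρ X X = 0 ↔ X = 0 := by
  refine ⟨fun h => ?_, fun h => by simp [h, rldInner]⟩
  rw [rldInner, Matrix.trace_mul_comm, ← Matrix.mul_assoc,
    (hρ.posSemidef.conjTranspose_mul_mul_same X).trace_eq_zero_iff] at h
  refine Matrix.ext_of_mulVec_single fun i => ?_
  rw [Matrix.zero_mulVec]
  by_contra hv
  have h6 := hρ.dotProduct_mulVec_pos hv
  rw [Matrix.star_mulVec, ← Matrix.dotProduct_mulVec, Matrix.mulVec_mulVec,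
      Matrix.mulVec_mulVec, h] at h6
  simp at h6

lemma rldInner_conj (hρ : ρ.PosDef) (X Y : Matrix (Fin d) (Fin d) ℂ) :
    star (rldInner ρ X Y) = rldInner ρ Y X := by
  rw [rldInner, ← Matrix.trace_conjTranspose, Matrix.conjTranspose_mul, Matrix.conjTranspose_mul,
    Matrix.conjTranspose_conjTranspose, hρ.isHermitian.eq, ← Matrix.mul_assoc,
    Matrix.trace_mul_cycle, rldInner]

lemma sldInner_eq_re (hρ : ρ.PosDef) {X Y : Matrix (Fin d) (Fin d) ℂ}
    (hX : X.IsHermitian) (hY : Y.IsHermitian) :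
    sldInner ρ X Y = ((rldInner ρ X Y).re : ℂ) := by
  have h : (ρ * X * Y).trace = star (rldInner ρ X Y) := by
    rw [rldInner_conj hρ, rldInner, hY.eq]
  rw [Complex.re_eq_add_conj, sldInner, Matrix.mul_add, Matrix.trace_add, hX.eq,
    ← Matrix.mul_assoc, ← Matrix.mul_assoc, h, rldInner, hX.eq]
  simp only [RCLike.star_def]
  ring

/-- The SLD represents the derivative with respect to the real part of the RLD inner product. -/
lemma trace_mul_eq_re_rldInner (hρ : ρ.PosDef) (hA : A.IsHermitian) (hX : X.IsHermitian) :
    (A * X).trace = ((rldInner ρ X (sldOp ρ A)).re : ℂ) := by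
  rw [← sldInner_eq_re hρ hX (sldOp_isHermitian hρ hA), trace_mul_eq_sldOp hρ, sldInner, hX.eq,
    Matrix.mul_add, Matrix.trace_add, Matrix.mul_assoc, Matrix.mul_assoc]

/-- The defect between the RLD and the SLD information of one direction is the squared norm of
the difference of the two logarithmic derivatives. -/
lemma rldInner_sub_sldInner_self (hρ : ρ.PosDef) (hA : A.IsHermitian) :
    rldInner ρ (rldOp ρ A) (rldOp ρ A) - sldInner ρ (sldOp ρ A) (sldOp ρ A) =
      rldInner ρ (rldOp ρ A - sldOp ρ A) (rldOp ρ A - sldOp ρ A) := by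
  have hL := sldOp_isHermitian hρ hA
  have hu : IsUnit ρ.det := (Matrix.isUnit_iff_isUnit_det _).1 hρ.isUnit
  have h0 : (A * sldOp ρ A).trace = (ρ * sldOp ρ A * sldOp ρ A).trace := by
    rw [trace_mul_eq_sldOp hρ]; ring
  have h1 : rldInner ρ (sldOp ρ A) (rldOp ρ A) = (ρ * sldOp ρ A * sldOp ρ A).trace := by
    rw [rldInner, ← rldOp_spec hρ, hL.eq, h0]
  have h2 : rldInner ρ (rldOp ρ A) (sldOp ρ A) = (ρ * sldOp ρ A * sldOp ρ A).trace := by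
    rw [← h0, rldInner, rldOp, Matrix.conjTranspose_mul, hA.eq, hρ.isHermitian.inv.eq,
      ← Matrix.mul_assoc, Matrix.trace_mul_comm, ← Matrix.mul_assoc, ← Matrix.mul_assoc,
      Matrix.nonsing_inv_mul _ hu, Matrix.one_mul, Matrix.trace_mul_comm]
  have h3 : sldInner ρ (sldOp ρ A) (sldOp ρ A) = (ρ * sldOp ρ A * sldOp ρ A).trace := by
    rw [sldInner, hL.eq, Matrix.mul_add, Matrix.trace_add, Matrix.mul_assoc]; ring
  have h4 : rldInner ρ (sldOp ρ A) (sldOp ρ A) = (ρ * sldOp ρ A * sldOp ρ A).trace := by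
    rw [rldInner, hL.eq]
  have h5 : rldInner ρ (rldOp ρ A - sldOp ρ A) (rldOp ρ A - sldOp ρ A) =
      rldInner ρ (rldOp ρ A) (rldOp ρ A) - rldInner ρ (rldOp ρ A) (sldOp ρ A)
        - rldInner ρ (sldOp ρ A) (rldOp ρ A) + rldInner ρ (sldOp ρ A) (sldOp ρ A) := by
    simp only [rldInner, Matrix.conjTranspose_sub, Matrix.mul_sub, Matrix.sub_mul,
      Matrix.trace_sub]
    ring
  rw [h5, h1, h2, h3, h4]; ring

/-- On operators commuting with the state the two inner products agree. -/
lemma sldInner_eq_rldInner_of_commute {Y : Matrix (Fin d) (Fin d) ℂ} (hY : Commute Y ρ) :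
    sldInner ρ X Y = rldInner ρ X Y := by
  rw [sldInner, Matrix.mul_add, Matrix.trace_add, Matrix.trace_mul_comm ρ (Xᴴ * Y),
    Matrix.mul_assoc Xᴴ, hY.eq, Matrix.trace_mul_comm Xᴴ, rldInner, ← Matrix.mul_assoc]
  ring

/-- A span consists of operators commuting with `ρ` as soon as the spanning family does. -/
lemma commute_span_iff {ι 𝕜 : Type*} [Semiring 𝕜] [Module 𝕜 (Matrix (Fin d) (Fin d) ℂ)]
    [SMulCommClass 𝕜 (Matrix (Fin d) (Fin d) ℂ) (Matrix (Fin d) (Fin d) ℂ)]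
    [IsScalarTower 𝕜 (Matrix (Fin d) (Fin d) ℂ) (Matrix (Fin d) (Fin d) ℂ)]
    (f : ι → Matrix (Fin d) (Fin d) ℂ) (ρ : Matrix (Fin d) (Fin d) ℂ) :
    (∀ X ∈ Submodule.span 𝕜 (Set.range f), X * ρ - ρ * X = 0) ↔ ∀ i, Commute (f i) ρ := by
  refine ⟨fun h i => sub_eq_zero.1 (h _ (Submodule.subset_span ⟨i, rfl⟩)), fun h X hX => ?_⟩
  refine sub_eq_zero.2 (show Commute X ρ from ?_)
  induction hX using Submodule.span_induction with
  | mem x hx => obtain ⟨i, rfl⟩ := hx; exact h i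
  | zero => exact Commute.zero_left ρ
  | add x y _ _ hx hy => exact hx.add_left hy
  | smul a x _ hx => exact hx.smul_left a

end QuantumState

/-! ### Matrix families commuting with their derivatives -/

noncomputable section CommutingCurves

open scoped Matrix.Norms.Elementwise

variable {d : ℕ}

/-- The off-diagonal part of a matrix, as a real-linear map. -/
def offDiagonal (d : ℕ) : Matrix (Fin d) (Fin d) ℂ →ₗ[ℝ] Matrix (Fin d) (Fin d) ℂ where
  toFun Y := Matrix.of fun a b => if a = b then 0 else Y a b
  map_add' X Y := by ext a b; by_cases h : a = b <;> simp [h]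
  map_smul' c X := by ext a b; by_cases h : a = b <;> simp [h]

lemma offDiagonal_apply_self (Y : Matrix (Fin d) (Fin d) ℂ) (a : Fin d) :
    offDiagonal d Y a a = 0 := by simp [offDiagonal]

lemma offDiagonal_apply_ne (Y : Matrix (Fin d) (Fin d) ℂ) {a b : Fin d} (h : a ≠ b) :
    offDiagonal d Y a b = Y a b := by simp [offDiagonal, h]

lemma offDiagonal_eq_zero_iff {Y : Matrix (Fin d) (Fin d) ℂ} :
    offDiagonal d Y = 0 ↔ ∃ c : Fin d → ℂ, Y = Matrix.diagonal c := by
  refine ⟨fun h => ⟨fun a => Y a a, ?_⟩, ?_⟩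
  · ext a b
    by_cases hab : a = b
    · simp [hab]
    · rw [← offDiagonal_apply_ne Y hab, h, Matrix.diagonal_apply_ne _ hab, Matrix.zero_apply]
  · rintro ⟨c, rfl⟩
    ext a b
    by_cases hab : a = b
    · simp [hab, offDiagonal_apply_self]
    · simp [offDiagonal_apply_ne _ hab, hab]

/-- A matrix that commutes with a diagonal matrix without repeated entries is diagonal. -/
lemma offDiagonal_eq_zero_of_commute_diagonal {Y : Matrix (Fin d) (Fin d) ℂ} {c : Fin d → ℂ}
    (hc : Function.Injective c) (h : Commute Y (Matrix.diagonal c)) : offDiagonal d Y = 0 := by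
  ext a b
  by_cases hab : a = b
  · simp [hab, offDiagonal_apply_self]
  · have h1 := congrFun (congrFun h.eq a) b
    rw [Matrix.mul_diagonal, Matrix.diagonal_mul] at h1
    have h2 : (c b - c a) * Y a b = 0 := by linear_combination h1
    rw [offDiagonal_apply_ne _ hab, Matrix.zero_apply]
    exact (mul_eq_zero.1 h2).resolve_left (sub_ne_zero.2 fun h => hab (hc h).symm)

/-- If `X` commutes with `Y` and the diagonal entries of `Y` are separated, then the off-diagonal
part of `X` is controlled by that of `Y`: the commutator of `X` with the diagonal part of `Y`
multiplies the entries of `X` by the gaps, and it is minus the commutator with the off-diagonal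
part of `Y`. -/
lemma norm_offDiagonal_le_of_commute {X Y : Matrix (Fin d) (Fin d) ℂ} (h : Commute X Y)
    {γ K : ℝ} (hγ : 0 < γ) (hY : ∀ a b, a ≠ b → γ ≤ ‖Y b b - Y a a‖) (hX : ‖X‖ ≤ K) :
    ‖offDiagonal d X‖ ≤ (2 * d * K / γ) * ‖offDiagonal d Y‖ := by
  have hK : 0 ≤ K := (norm_nonneg X).trans hX
  rw [Matrix.norm_le_iff (by positivity)]
  intro a b
  by_cases hab : a = b
  · subst hab
    rw [offDiagonal_apply_self, norm_zero]
    positivity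
  rw [offDiagonal_apply_ne _ hab]
  set O := offDiagonal d Y with hO
  have hdec : Y = Matrix.diagonal (fun c => Y c c) + O := by
    ext i j
    by_cases hij : i = j
    · subst hij
      simp [hO, offDiagonal_apply_self]
    · simp [hO, offDiagonal_apply_ne _ hij, hij]
  have h1 : X a b * (Y b b - Y a a) = (O * X) a b - (X * O) a b := by
    have h2 := congrFun (congrFun h.eq a) b
    have h3 : (X * Y) a b = X a b * Y b b + (X * O) a b := by
      conv_lhs => rw [hdec]
      rw [Matrix.mul_add, Matrix.add_apply, Matrix.mul_diagonal]
    have h4 : (Y * X) a b = Y a a * X a b + (O * X) a b := by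
      conv_lhs => rw [hdec]
      rw [Matrix.add_mul, Matrix.add_apply, Matrix.diagonal_mul]
    linear_combination h2 - h3 + h4
  have hprod : ∀ P Q : Matrix (Fin d) (Fin d) ℂ, ‖(P * Q) a b‖ ≤ d * (‖P‖ * ‖Q‖) := by
    intro P Q
    rw [Matrix.mul_apply]
    refine (norm_sum_le _ _).trans ((Finset.sum_le_card_nsmul _ _ (‖P‖ * ‖Q‖) ?_).trans ?_)
    · intro c _
      rw [norm_mul]
      exact mul_le_mul (Matrix.norm_entry_le_entrywise_sup_norm P)
        (Matrix.norm_entry_le_entrywise_sup_norm Q) (norm_nonneg _) (norm_nonneg _)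
    · simp
  have h5 : ‖X a b‖ * γ ≤ 2 * d * K * ‖O‖ := by
    calc ‖X a b‖ * γ ≤ ‖X a b‖ * ‖Y b b - Y a a‖ := by gcongr; exact hY a b hab
      _ = ‖(O * X) a b - (X * O) a b‖ := by rw [← norm_mul, h1]
      _ ≤ d * (‖O‖ * ‖X‖) + d * (‖X‖ * ‖O‖) :=
        (norm_sub_le _ _).trans (add_le_add (hprod _ _) (hprod _ _))
      _ = 2 * d * ‖X‖ * ‖O‖ := by ring
      _ ≤ 2 * d * K * ‖O‖ := by gcongr
  calc ‖X a b‖ ≤ 2 * d * K * ‖O‖ / γ := (le_div_iff₀ hγ).2 h5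
    _ = (2 * d * K / γ) * ‖O‖ := by ring

/-- If the derivatives of a `C¹` matrix family commute with the matrix at the same point, and the
matrix at `x₀` is diagonal without repeated entries, then the family is diagonal near `x₀`. Along
segments from `x₀` the off-diagonal part satisfies a homogeneous linear differential inequality
with zero initial value, so Grönwall's lemma applies. -/
lemma eventually_offDiagonal_eq_zero {E : Type*} [NormedAddCommGroup E] [NormedSpace ℝ E]
    {R : E → Matrix (Fin d) (Fin d) ℂ} {s : Set E} (hs : IsOpen s) (hR : ContDiffOn ℝ 1 R s)
    (hcomm : ∀ x ∈ s, ∀ v, Commute (fderiv ℝ R x v) (R x)) {x₀ : E} (hx₀ : x₀ ∈ s)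
    {c : Fin d → ℂ} (hc : Function.Injective c) (hRc : R x₀ = Matrix.diagonal c) :
    ∀ᶠ x in nhds x₀, offDiagonal d (R x) = 0 := by
  have hsn : s ∈ nhds x₀ := hs.mem_nhds hx₀
  have hcont : ContinuousAt R x₀ := hR.continuousOn.continuousAt hsn
  have hentry : ∀ a b, ContinuousAt (fun x => R x a b) x₀ := fun a b =>
    continuousAt_pi.1 (continuousAt_pi.1 hcont a) b
  obtain ⟨γ, hγ, hgap⟩ : ∃ γ : ℝ, 0 < γ ∧ ∀ᶠ x in nhds x₀, ∀ a b, a ≠ b →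
      γ ≤ ‖R x b b - R x a a‖ := by
    obtain ⟨γ, hγ, hγ'⟩ : ∃ γ : ℝ, 0 < γ ∧ ∀ p : Fin d × Fin d, p.1 ≠ p.2 →
        γ < ‖c p.2 - c p.1‖ := by
      have : ∀ᶠ γ in nhdsWithin (0 : ℝ) (Set.Ioi 0), ∀ p : Fin d × Fin d, p.1 ≠ p.2 →
          γ < ‖c p.2 - c p.1‖ := by
        rw [Filter.eventually_all]
        intro p
        by_cases hp : p.1 = p.2
        · simp [hp]
        · have h0 : 0 < ‖c p.2 - c p.1‖ :=
            norm_pos_iff.2 (sub_ne_zero.2 fun h => hp (hc h).symm)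
          filter_upwards [nhdsWithin_le_nhds (Iio_mem_nhds h0)] with γ hγ _ using hγ
      obtain ⟨γ, h1, h2⟩ := (this.and self_mem_nhdsWithin).exists
      exact ⟨γ, h2, h1⟩
    refine ⟨γ, hγ, ?_⟩
    simp only [Filter.eventually_all]
    intro a b hab
    have h1 : ContinuousAt (fun x => ‖R x b b - R x a a‖) x₀ :=
      ((hentry b b).sub (hentry a a)).norm
    have h2 : γ < ‖R x₀ b b - R x₀ a a‖ := by
      simpa [hRc] using hγ' (a, b) hab
    filter_upwards [h1.eventually (lt_mem_nhds h2)] with x hx using hx.le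
  -- The operator norm is taken in the function space underlying the matrix space, whose topology
  -- is syntactically the one of the norm.
  obtain ⟨K, hK⟩ : ∃ K : ℝ, ∀ᶠ x in nhds x₀, ∀ v, ‖fderiv ℝ R x v‖ ≤ K * ‖v‖ := by
    let F : E → Fin d → Fin d → ℂ := R
    have hF : ContDiffOn ℝ 1 F s := hR
    have hfd : ContinuousAt (fderiv ℝ F) x₀ :=
      (hF.continuousOn_fderiv_of_isOpen hs le_rfl).continuousAt hsn
    refine ⟨‖fderiv ℝ F x₀‖ + 1, ?_⟩
    filter_upwards [hfd.norm.eventually (gt_mem_nhds (lt_add_one _))] with x hx v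
    exact ContinuousLinearMap.le_of_opNorm_le (fderiv ℝ F x) hx.le v
  obtain ⟨r, hr, hball⟩ := Metric.eventually_nhds_iff_ball.1 ((hgap.and hK).and hsn)
  filter_upwards [Metric.ball_mem_nhds x₀ hr] with x hx
  set v := x - x₀ with hv
  have hmem : ∀ t ∈ Set.Icc (0 : ℝ) 1, x₀ + t • v ∈ Metric.ball x₀ r := by
    intro t ht
    exact (convex_ball x₀ r).add_smul_sub_mem (Metric.mem_ball_self hr) hx ht
  have hder : ∀ t ∈ Set.Icc (0 : ℝ) 1, HasDerivAt (fun t : ℝ => offDiagonal d (R (x₀ + t • v)))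
      (offDiagonal d (fderiv ℝ R (x₀ + t • v) v)) t := by
    intro t ht
    have h1 : HasFDerivAt R (fderiv ℝ R (x₀ + t • v)) (x₀ + t • v) :=
      ((hR.differentiableOn one_ne_zero).differentiableAt
        (hs.mem_nhds (hball _ (hmem t ht)).2)).hasFDerivAt
    have h2 : HasDerivAt (fun t : ℝ => x₀ + t • v) v t := by
      simpa using ((hasDerivAt_id t).smul_const v).const_add x₀
    exact (LinearMap.toContinuousLinearMap (offDiagonal d)).hasFDerivAt.comp_hasDerivAt t
      (h1.comp_hasDerivAt t h2)
  have hzero := eq_zero_of_abs_deriv_le_mul_abs_self_of_eq_zero_right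
    (f := fun t : ℝ => offDiagonal d (R (x₀ + t • v)))
    (f' := fun t : ℝ => offDiagonal d (fderiv ℝ R (x₀ + t • v) v))
    (K := 2 * d * (K * ‖v‖) / γ) (a := 0) (b := 1)
    (fun t ht => (hder t ht).continuousAt.continuousWithinAt)
    (fun t ht => (hder t (Set.Ico_subset_Icc_self ht)).hasDerivWithinAt)
    (by simp only [zero_smul, add_zero]; exact offDiagonal_eq_zero_iff.2 ⟨c, hRc⟩)
    (fun t ht => by
      obtain ⟨⟨hg, hk⟩, hm⟩ := hball _ (hmem t (Set.Ico_subset_Icc_self ht))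
      exact norm_offDiagonal_le_of_commute (hcomm _ hm v) hγ hg (hk v))
  have := hzero 1 (Set.right_mem_Icc.2 zero_le_one)
  simpa [hv] using this

end CommutingCurves

section SimpleSpectrum

variable {d : ℕ}

/-- Conjugation by a unitary matrix, `X ↦ U† X U`, as a real-linear map. -/
noncomputable def unitaryConj (U : Matrix (Fin d) (Fin d) ℂ) :
    Matrix (Fin d) (Fin d) ℂ →ₗ[ℝ] Matrix (Fin d) (Fin d) ℂ :=
  LinearMap.mulLeft ℝ (star U) ∘ₗ LinearMap.mulRight ℝ U

lemma unitaryConj_apply (U X : Matrix (Fin d) (Fin d) ℂ) :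
    unitaryConj U X = star U * (X * U) := rfl

lemma commute_unitaryConj_iff {U : Matrix (Fin d) (Fin d) ℂ}
    (hU : U ∈ Matrix.unitaryGroup (Fin d) ℂ) {X Y : Matrix (Fin d) (Fin d) ℂ} :
    Commute (unitaryConj U X) (unitaryConj U Y) ↔ Commute X Y := by
  have h1 : U * star U = 1 := Matrix.mem_unitaryGroup_iff.1 hU
  have hmul : ∀ P Q, unitaryConj U P * unitaryConj U Q = unitaryConj U (P * Q) := by
    intro P Q
    simp only [unitaryConj_apply, Matrix.mul_assoc]
    rw [← Matrix.mul_assoc U, h1, Matrix.one_mul]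
  have hinj : Function.Injective (unitaryConj U) := by
    intro P Q h
    have h2 := congrArg (fun Z => U * Z * star U) h
    simpa [unitaryConj_apply, Matrix.mul_assoc, h1, ← Matrix.mul_assoc U] using h2
  rw [commute_iff_eq, commute_iff_eq, hmul, hmul, hinj.eq_iff]

/-- A Hermitian matrix with simple spectrum becomes diagonal, without repeated entries, in a
unitary basis. -/
lemma exists_unitaryConj_eq_diagonal {ρ : Matrix (Fin d) (Fin d) ℂ} (hρ : ρ.IsHermitian)
    (h : Function.Injective hρ.eigenvalues) :
    ∃ U ∈ Matrix.unitaryGroup (Fin d) ℂ, ∃ c : Fin d → ℂ, Function.Injective c ∧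
      unitaryConj U ρ = Matrix.diagonal c := by
  refine ⟨hρ.eigenvectorUnitary, hρ.eigenvectorUnitary.2, fun i => (hρ.eigenvalues i : ℂ),
    fun i j hij => h (Complex.ofReal_injective hij), ?_⟩
  have := hρ.conjStarAlgAut_star_eigenvectorUnitary
  rw [Unitary.conjStarAlgAut_star_apply] at this
  rw [unitaryConj_apply, ← Matrix.mul_assoc, this]
  rfl

/-- Two matrices that commute with a Hermitian matrix with simple spectrum commute. -/
lemma commute_of_commute_of_simple {ρ X Y : Matrix (Fin d) (Fin d) ℂ} (hρ : ρ.IsHermitian)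
    (h : Function.Injective hρ.eigenvalues) (hX : Commute X ρ) (hY : Commute Y ρ) :
    Commute X Y := by
  obtain ⟨U, hU, c, hc, hd⟩ := exists_unitaryConj_eq_diagonal hρ h
  rw [← commute_unitaryConj_iff hU] at hX hY ⊢
  rw [hd] at hX hY
  obtain ⟨p, hp⟩ := offDiagonal_eq_zero_iff.1 (offDiagonal_eq_zero_of_commute_diagonal hc hX)
  obtain ⟨q, hq⟩ := offDiagonal_eq_zero_iff.1 (offDiagonal_eq_zero_of_commute_diagonal hc hY)
  rw [hp, hq]
  exact Matrix.commute_diagonal p q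

end SimpleSpectrum

/-! ### Classical models -/

namespace QuantumModel

open QuantumState

variable {n d : ℕ} {M : QuantumModel n d} {θ : Fin n → ℝ}

section Derivatives

open scoped Matrix.Norms.Elementwise

lemma IsRegular.contDiffOn (hreg : M.IsRegular) : ContDiffOn ℝ ∞ M.ρ M.Θ :=
  contDiffOn_pi.2 fun a => contDiffOn_pi.2 fun b => hreg.smooth a b

lemma IsRegular.differentiableAt (hreg : M.IsRegular) (hθ : θ ∈ M.Θ) :
    DifferentiableAt ℝ M.ρ θ :=
  (hreg.contDiffOn.differentiableOn (by simp)).differentiableAt (M.isOpen.mem_nhds hθ)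

lemma IsRegular.fderiv_single (hreg : M.IsRegular) (hθ : θ ∈ M.Θ) (i : Fin n) :
    fderiv ℝ M.ρ θ (Pi.single i 1) = M.partialDeriv θ i := by
  ext a b
  have h := (hasFDerivAt_pi'.1 ((hasFDerivAt_pi'.1
    (hreg.differentiableAt hθ).hasFDerivAt) a)) b
  rw [partialDeriv, Matrix.of_apply, h.fderiv]
  rfl

lemma IsRegular.fderiv_apply (hreg : M.IsRegular) (hθ : θ ∈ M.Θ) (v : Fin n → ℝ) :
    fderiv ℝ M.ρ θ v = ∑ i, v i • M.partialDeriv θ i := by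
  conv_lhs => rw [pi_eq_sum_univ' v]
  simp only [map_sum, map_smul, ← hreg.fderiv_single hθ]

/-- A linear map that is constant on the states of the model vanishes on the derivatives. -/
lemma IsRegular.map_partialDeriv_eq_zero (hreg : M.IsRegular) (hθ : θ ∈ M.Θ) {V : Type*}
    [NormedAddCommGroup V] [NormedSpace ℝ V] (Φ : Matrix (Fin d) (Fin d) ℂ →ₗ[ℝ] V) {w : V}
    (hΦ : ∀ θ' ∈ M.Θ, Φ (M.ρ θ') = w) (i : Fin n) : Φ (M.partialDeriv θ i) = 0 := by
  have h1 : HasFDerivAt (fun θ' => Φ (M.ρ θ'))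
      ((LinearMap.toContinuousLinearMap Φ).comp (fderiv ℝ M.ρ θ)) θ :=
    (LinearMap.toContinuousLinearMap Φ).hasFDerivAt.comp θ (hreg.differentiableAt hθ).hasFDerivAt
  have h2 : HasFDerivAt (fun θ' => Φ (M.ρ θ')) (0 : (Fin n → ℝ) →L[ℝ] V) θ :=
    (hasFDerivAt_const w θ).congr_of_eventuallyEq
      (Filter.eventually_of_mem (M.isOpen.mem_nhds hθ) hΦ)
  have h3 := congrArg (fun T : (Fin n → ℝ) →L[ℝ] V => T (Pi.single i 1)) (h1.unique h2)
  rw [← hreg.fderiv_single hθ]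
  exact h3

lemma IsRegular.partialDeriv_isHermitian (hreg : M.IsRegular) (hθ : θ ∈ M.Θ) (i : Fin n) :
    (M.partialDeriv θ i).IsHermitian := by
  have h := hreg.map_partialDeriv_eq_zero hθ
    ((Matrix.conjTransposeLinearEquiv (Fin d) (Fin d) ℝ ℂ).toLinearMap - LinearMap.id) (w := 0)
    (fun θ' hθ' => sub_eq_zero.2 (M.posDef θ' hθ').isHermitian) i
  exact sub_eq_zero.1 h

lemma IsRegular.trace_partialDeriv (hreg : M.IsRegular) (hθ : θ ∈ M.Θ) (i : Fin n) :
    (M.partialDeriv θ i).trace = 0 :=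
  hreg.map_partialDeriv_eq_zero hθ (Matrix.traceLinearMap (Fin d) ℝ ℂ) (w := 1)
    (fun θ' hθ' => M.trace_one θ' hθ') i

/-- If the states of the model commute pairwise, then each commutes with the derivatives. -/
lemma IsRegular.commute_partialDeriv (hreg : M.IsRegular)
    (h : ∀ θ ∈ M.Θ, ∀ θ' ∈ M.Θ, Commute (M.ρ θ) (M.ρ θ')) (hθ : θ ∈ M.Θ) (i : Fin n) :
    Commute (M.partialDeriv θ i) (M.ρ θ) := by
  have h := hreg.map_partialDeriv_eq_zero hθ
    (LinearMap.mulRight ℝ (M.ρ θ) - LinearMap.mulLeft ℝ (M.ρ θ)) (w := 0)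
    (fun θ' hθ' => sub_eq_zero.2 (h θ' hθ' θ hθ).eq) i
  exact sub_eq_zero.1 h

/-- If the derivatives commute with the state at every point, then each state commutes with the
states at all nearby points. -/
lemma IsRegular.eventually_commute (hreg : M.IsRegular)
    (h : ∀ θ ∈ M.Θ, ∀ i, Commute (M.partialDeriv θ i) (M.ρ θ)) (hθ : θ ∈ M.Θ) :
    ∀ᶠ θ' in nhds θ, Commute (M.ρ θ) (M.ρ θ') := by
  obtain ⟨U, hU, c, hc, hd⟩ := exists_unitaryConj_eq_diagonal _ (hreg.nondegenerate θ hθ)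
  have hder : ∀ x ∈ M.Θ, HasFDerivAt (fun x => unitaryConj U (M.ρ x))
      ((LinearMap.toContinuousLinearMap (unitaryConj U)).comp (fderiv ℝ M.ρ x)) x := fun x hx =>
    (LinearMap.toContinuousLinearMap (unitaryConj U)).hasFDerivAt.comp x
      (hreg.differentiableAt hx).hasFDerivAt
  have hsmooth : ContDiffOn ℝ 1 (fun x => unitaryConj U (M.ρ x)) M.Θ :=
    (LinearMap.toContinuousLinearMap (unitaryConj U)).contDiff.comp_contDiffOn
      (hreg.contDiffOn.of_le (by exact_mod_cast le_top))
  have hev := eventually_offDiagonal_eq_zero M.isOpen hsmooth (fun x hx v => by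
    rw [(hder x hx).fderiv]
    change Commute (unitaryConj U (fderiv ℝ M.ρ x v)) _
    rw [commute_unitaryConj_iff hU, hreg.fderiv_apply hx]
    exact Commute.sum_left _ _ _ fun i _ => (h x hx i).smul_left _) hθ hc hd
  filter_upwards [hev] with x hx
  obtain ⟨p, hp⟩ := offDiagonal_eq_zero_iff.1 hx
  rw [← commute_unitaryConj_iff hU, hd, hp]
  exact Matrix.commute_diagonal c p

end Derivatives

/-- On a connected parameter set, infinitesimal commutativity integrates to commutativity. -/
lemma IsRegular.commute_of_isPreconnected (hreg : M.IsRegular) (hconn : IsPreconnected M.Θ)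
    (h : ∀ θ ∈ M.Θ, ∀ i, Commute (M.partialDeriv θ i) (M.ρ θ)) {θ' : Fin n → ℝ}
    (hθ : θ ∈ M.Θ) (hθ' : θ' ∈ M.Θ) : Commute (M.ρ θ) (M.ρ θ') :=
  hconn.induction₂ (fun x y => Commute (M.ρ x) (M.ρ y))
    (fun _ hx => nhdsWithin_le_nhds (hreg.eventually_commute h hx))
    (fun _ y _ _ hy _ hxy hyz => commute_of_commute_of_simple _ (hreg.nondegenerate y hy) hxy
      hyz.symm)
    (fun _ _ _ _ hxy => hxy.symm) hθ hθ'

/-- A model is classical exactly when its states commute pairwise. -/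
lemma IsRegular.isClassical_iff_commute (hreg : M.IsRegular) :
    M.IsClassical ↔ ∀ θ ∈ M.Θ, ∀ θ' ∈ M.Θ, Commute (M.ρ θ) (M.ρ θ') := by
  constructor
  · rintro ⟨U, hU, h⟩ θ hθ θ' hθ'
    obtain ⟨p, hp⟩ := h θ hθ
    obtain ⟨q, hq⟩ := h θ' hθ'
    have h1 : U⁻¹ * U = 1 := Matrix.nonsing_inv_mul _
      ((Matrix.isUnit_iff_isUnit_det U).1 (Unitary.isUnit_coe (U := ⟨U, hU⟩)))
    rw [hp, hq, commute_iff_eq]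
    simp only [Matrix.mul_assoc]
    rw [← Matrix.mul_assoc U⁻¹ U, ← Matrix.mul_assoc U⁻¹ U, h1, Matrix.one_mul, Matrix.one_mul,
      ← Matrix.mul_assoc (Matrix.diagonal _) (Matrix.diagonal _),
      ← Matrix.mul_assoc (Matrix.diagonal _) (Matrix.diagonal _), (Matrix.commute_diagonal _ _).eq]
  · intro h
    rcases M.Θ.eq_empty_or_nonempty with he | ⟨θ₀, hθ₀⟩
    · exact ⟨1, one_mem _, by simp [he]⟩
    obtain ⟨U, hU, c, hc, hd⟩ := exists_unitaryConj_eq_diagonal _ (hreg.nondegenerate θ₀ hθ₀)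
    refine ⟨U, hU, fun θ hθ => ?_⟩
    have h1 : U * star U = 1 := Matrix.mem_unitaryGroup_iff.1 hU
    have h2 := (commute_unitaryConj_iff hU).2 (h θ hθ θ₀ hθ₀)
    rw [hd] at h2
    obtain ⟨p, hp⟩ := offDiagonal_eq_zero_iff.1 (offDiagonal_eq_zero_of_commute_diagonal hc h2)
    have hherm : (unitaryConj U (M.ρ θ)).IsHermitian := by
      have h3 := Matrix.isHermitian_conjTranspose_mul_mul U (M.posDef θ hθ).isHermitian
      rwa [unitaryConj_apply, ← Matrix.mul_assoc]
    -- The diagonal entries are real because conjugation preserves Hermitian matrices.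
    have hreal : (fun k => ((p k).re : ℂ)) = p := by
      funext k
      have h4 := hherm.coe_re_apply_self k
      rw [hp, Matrix.diagonal_apply_eq] at h4
      exact h4
    refine ⟨fun k => (p k).re, ?_⟩
    rw [hreal, ← hp, unitaryConj_apply, Matrix.inv_eq_right_inv h1, ← Matrix.mul_assoc U, h1,
      Matrix.one_mul, Matrix.mul_assoc, h1, Matrix.mul_one]

end QuantumModel

/-! ### Trace norm and RLD inner product -/

section TraceNorm

variable {n : ℕ}

lemma trace_mul_nonneg {W P : Matrix (Fin n) (Fin n) ℝ} (hW : W.PosSemidef) (hP : P.PosSemidef) :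
    0 ≤ (W * P).trace := by
  obtain ⟨B, rfl⟩ := CStarAlgebra.nonneg_iff_eq_star_mul_self.1 (Matrix.nonneg_iff_posSemidef.2 hW)
  rw [Matrix.mul_assoc, Matrix.trace_mul_comm]
  exact (hP.mul_mul_conjTranspose_same B).trace_nonneg

lemma trace_cfcAbs_nonneg (A : Matrix (Fin n) (Fin n) ℝ) : 0 ≤ (CFC.abs A).trace :=
  (Matrix.nonneg_iff_posSemidef.1 (CFC.abs_nonneg A)).trace_nonneg

/-- Each entry of a matrix is bounded by its trace norm. -/
lemma abs_entry_le_trace_cfcAbs (A : Matrix (Fin n) (Fin n) ℝ) (i j : Fin n) :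
    |A i j| ≤ (CFC.abs A).trace := by
  obtain ⟨B, hB⟩ := CStarAlgebra.nonneg_iff_eq_star_mul_self.1 (CFC.abs_nonneg A)
  have hentry : ∀ k l, CFC.abs A k l = ∑ c, B c k * B c l := fun k l => by
    rw [hB]; simp [Matrix.mul_apply, Matrix.star_apply]
  have hcs : ∀ k l, CFC.abs A k l * CFC.abs A l k ≤ CFC.abs A k k * CFC.abs A l l := by
    intro k l
    have h := Finset.sum_mul_sq_le_sq_mul_sq Finset.univ (fun c => B c k) (fun c => B c l)
    simp only [hentry]
    calc (∑ c, B c k * B c l) * ∑ c, B c l * B c k = (∑ c, B c k * B c l) ^ 2 := by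
          rw [sq]; simp only [mul_comm]
      _ ≤ _ := by simpa only [sq] using h
  -- The square of the trace norm dominates the sum of the squares of the entries.
  have hdom : (Aᴴ * A).trace ≤ (CFC.abs A).trace ^ 2 := by
    rw [← Matrix.star_eq_conjTranspose, ← CFC.abs_mul_abs, sq]
    simp only [Matrix.trace, Matrix.diag_apply, Matrix.mul_apply]
    rw [Finset.sum_mul_sum]
    exact Finset.sum_le_sum fun k _ => Finset.sum_le_sum fun l _ => hcs k l
  have hsum : A i j ^ 2 ≤ (Aᴴ * A).trace := by
    simp only [Matrix.trace, Matrix.diag_apply, Matrix.mul_apply, Matrix.conjTranspose_apply,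
      star_trivial, ← sq]
    exact (Finset.single_le_sum (f := fun l => A l j ^ 2) (fun l _ => sq_nonneg _)
        (Finset.mem_univ i)).trans
      (Finset.single_le_sum (f := fun k => ∑ l, A l k ^ 2)
        (fun k _ => Finset.sum_nonneg fun l _ => sq_nonneg _) (Finset.mem_univ j))
  exact abs_le_of_sq_le_sq (hsum.trans hdom) (trace_cfcAbs_nonneg A)

end TraceNorm

namespace QuantumState

variable {d : ℕ} {ρ X Y Z : Matrix (Fin d) (Fin d) ℂ}

/-- The RLD inner product as a real-bilinear map. -/
noncomputable def rldForm (ρ : Matrix (Fin d) (Fin d) ℂ) :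
    Matrix (Fin d) (Fin d) ℂ →ₗ[ℝ] Matrix (Fin d) (Fin d) ℂ →ₗ[ℝ] ℂ :=
  LinearMap.mk₂ ℝ (rldInner ρ)
    (fun X X' Y => by simp [rldInner, Matrix.mul_add])
    (fun c X Y => by simp [rldInner])
    (fun X Y Y' => by simp [rldInner, Matrix.mul_add, Matrix.add_mul])
    (fun c X Y => by simp [rldInner])

lemma rldForm_apply (ρ X Y : Matrix (Fin d) (Fin d) ℂ) : rldForm ρ X Y = rldInner ρ X Y := rfl

lemma re_rldInner_comm (hρ : ρ.PosDef) (X Y : Matrix (Fin d) (Fin d) ℂ) :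
    (rldInner ρ X Y).re = (rldInner ρ Y X).re := by
  rw [← rldInner_conj hρ]; simp

lemma im_rldInner_comm (hρ : ρ.PosDef) (X Y : Matrix (Fin d) (Fin d) ℂ) :
    (rldInner ρ X Y).im = -(rldInner ρ Y X).im := by
  rw [← rldInner_conj hρ]; simp

/-- The commutation operator exchanges the imaginary and the real part of the RLD inner product
of Hermitian operators. -/
lemma im_rldInner_eq_neg_re_commOp (hρ : ρ.PosDef) (hY : Y.IsHermitian) (hZ : Z.IsHermitian)
    (hD : (commOp ρ Y).IsHermitian) :
    (rldInner ρ Y Z).im = -(rldInner ρ (commOp ρ Y) Z).re := by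
  have h := congrArg (fun T => (T * Z).trace) (commOp_spec hρ Y)
  simp only [Matrix.sub_mul, Matrix.add_mul, Matrix.smul_mul, Matrix.trace_sub, Matrix.trace_add,
    Matrix.trace_smul, smul_eq_mul] at h
  have key : ∀ T : Matrix (Fin d) (Fin d) ℂ, T.IsHermitian →
      (ρ * T * Z).trace = star (rldInner ρ T Z) ∧ (T * ρ * Z).trace = rldInner ρ T Z := by
    intro T hT
    exact ⟨by rw [rldInner_conj hρ, rldInner, hZ.eq],
      by rw [rldInner, hT.eq, Matrix.trace_mul_cycle T, Matrix.trace_mul_cycle Z]⟩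
  rw [(key _ hY).1, (key _ hY).2, (key _ hD).1, (key _ hD).2] at h
  have h2 := congrArg Complex.im h
  simp at h2
  linarith

/-- Positivity of the RLD inner product on `X ± i Y`. -/
lemma abs_im_rldInner_le (hρ : ρ.PosDef) (X Y : Matrix (Fin d) (Fin d) ℂ) :
    2 * |(rldInner ρ X Y).im| ≤ (rldInner ρ X X).re + (rldInner ρ Y Y).re := by
  have hexp : ∀ c : ℂ, rldInner ρ (X + c • Y) (X + c • Y) = rldInner ρ X X + c * rldInner ρ X Y +
      star c * rldInner ρ Y X + c * star c * rldInner ρ Y Y := by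
    intro c
    simp only [rldInner, Matrix.conjTranspose_add, Matrix.conjTranspose_smul, Matrix.mul_add,
      Matrix.add_mul, Matrix.mul_smul, Matrix.smul_mul, Matrix.trace_add, Matrix.trace_smul,
      smul_eq_mul]
    ring
  have hc := im_rldInner_comm hρ X Y
  have h1 := (Complex.nonneg_iff.1 (rldInner_self_nonneg hρ (X + Complex.I • Y))).1
  have h2 := (Complex.nonneg_iff.1 (rldInner_self_nonneg hρ (X + (-Complex.I) • Y))).1
  rw [hexp] at h1 h2
  simp at h1 h2
  rcases abs_cases (rldInner ρ X Y).im with h | h <;> linarith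

end QuantumState

/-! ### The Holevo bound -/

namespace QuantumModel

open QuantumState

variable {n d : ℕ} {M : QuantumModel n d} {θ : Fin n → ℝ}

/-- The SLD Fisher information matrix as a real matrix. The SLDs being Hermitian, their SLD inner
products are the real parts of their RLD inner products. -/
noncomputable def realFisher (M : QuantumModel n d) (θ : Fin n → ℝ) : Matrix (Fin n) (Fin n) ℝ :=
  Matrix.of fun i j => (rldInner (M.ρ θ) (M.sld θ i) (M.sld θ j)).re

/-- The family dual to the SLDs inside the SLD tangent space, `Xⁱ = ∑ⱼ (G⁻¹)ᵢⱼ Lⱼ`. -/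
noncomputable def dualSld (M : QuantumModel n d) (θ : Fin n → ℝ) (i : Fin n) :
    Matrix (Fin d) (Fin d) ℂ :=
  ∑ j, (M.realFisher θ)⁻¹ i j • M.sld θ j

lemma IsRegular.sld_isHermitian (hreg : M.IsRegular) (hθ : θ ∈ M.Θ) (i : Fin n) :
    (M.sld θ i).IsHermitian :=
  sldOp_isHermitian (M.posDef θ hθ) (hreg.partialDeriv_isHermitian hθ i)

lemma IsRegular.isHermitian_of_mem_sldTangent (hreg : M.IsRegular) (hθ : θ ∈ M.Θ)
    {X : Matrix (Fin d) (Fin d) ℂ} (hX : X ∈ M.sldTangent θ) : X.IsHermitian := by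
  induction hX using Submodule.span_induction with
  | mem x hx => obtain ⟨i, rfl⟩ := hx; exact hreg.sld_isHermitian hθ i
  | zero => exact Matrix.isHermitian_zero
  | add x y _ _ hx hy => exact hx.add hy
  | smul a x _ hx => exact (IsSelfAdjoint.smul (IsSelfAdjoint.all a) hx :)

lemma sld_mem_sldTangent (M : QuantumModel n d) (θ : Fin n → ℝ) (i : Fin n) :
    M.sld θ i ∈ M.sldTangent θ := Submodule.subset_span ⟨i, rfl⟩

lemma dualSld_mem_sldTangent (M : QuantumModel n d) (θ : Fin n → ℝ) (i : Fin n) :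
    M.dualSld θ i ∈ M.sldTangent θ :=
  Submodule.sum_mem _ fun j _ => Submodule.smul_mem _ _ (sld_mem_sldTangent M θ j)

lemma IsRegular.sldFisher_eq (hreg : M.IsRegular) (hθ : θ ∈ M.Θ) :
    M.sldFisher θ = (M.realFisher θ).map Complex.ofReal := by
  ext i j
  exact sldInner_eq_re (M.posDef θ hθ) (hreg.sld_isHermitian hθ i) (hreg.sld_isHermitian hθ j)

lemma IsRegular.trace_partialDeriv_mul (hreg : M.IsRegular) (hθ : θ ∈ M.Θ) (i : Fin n)
    {X : Matrix (Fin d) (Fin d) ℂ} (hX : X.IsHermitian) :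
    (M.partialDeriv θ i * X).trace = ((rldInner (M.ρ θ) (M.sld θ i) X).re : ℂ) := by
  rw [trace_mul_eq_re_rldInner (M.posDef θ hθ) (hreg.partialDeriv_isHermitian hθ i) hX,
    re_rldInner_comm (M.posDef θ hθ)]
  rfl

lemma IsRegular.realFisher_posDef (hreg : M.IsRegular) (hθ : θ ∈ M.Θ) :
    (M.realFisher θ).PosDef := by
  have hρ := M.posDef θ hθ
  refine Matrix.PosDef.of_dotProduct_mulVec_pos ?_ fun v hv => ?_
  · ext i j
    simpa [realFisher] using re_rldInner_comm hρ (M.sld θ j) (M.sld θ i)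
  · set Y : Matrix (Fin d) (Fin d) ℂ := ∑ i, v i • M.sld θ i with hY
    have hYne : Y ≠ 0 := by
      intro h0
      apply hv
      have hA : ∑ i, v i • M.partialDeriv θ i = 0 := by
        have h1 : ∑ i, v i • M.partialDeriv θ i = (1 / 2 : ℂ) • (M.ρ θ * Y + Y * M.ρ θ) := by
          rw [hY, Finset.mul_sum, Finset.sum_mul, ← Finset.sum_add_distrib, Finset.smul_sum]
          refine Finset.sum_congr rfl fun i _ => ?_
          conv_lhs => rw [sldOp_spec hρ (M.partialDeriv θ i)]
          rw [Matrix.mul_smul, Matrix.smul_mul, ← smul_add, smul_comm]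
          rfl
        rw [h1, h0]; simp
      funext i
      exact Fintype.linearIndependent_iff.1 (hreg.linearIndependent θ hθ) v hA i
    have hform : star v ⬝ᵥ M.realFisher θ *ᵥ v = (rldForm (M.ρ θ) Y Y).re := by
      rw [hY]
      simp only [map_sum, map_smul, LinearMap.sum_apply, LinearMap.smul_apply, Complex.re_sum,
        Complex.smul_re, smul_eq_mul, dotProduct, Matrix.mulVec, realFisher, Matrix.of_apply,
        star_trivial, rldForm_apply, Finset.mul_sum]
      rw [Finset.sum_comm]
      refine Finset.sum_congr rfl fun i _ => Finset.sum_congr rfl fun j _ => ?_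
      ring
    rw [hform, rldForm_apply]
    have h0 := rldInner_self_nonneg hρ Y
    have h1 : rldInner (M.ρ θ) Y Y ≠ 0 := fun h => hYne ((rldInner_self_eq_zero hρ).1 h)
    exact (Complex.pos_iff.1 (lt_of_le_of_ne h0 h1.symm)).1

lemma IsRegular.isUnit_det_realFisher (hreg : M.IsRegular) (hθ : θ ∈ M.Θ) :
    IsUnit (M.realFisher θ).det :=
  (Matrix.isUnit_iff_isUnit_det _).1 (hreg.realFisher_posDef hθ).isUnit

lemma IsRegular.sldBound_eq (hreg : M.IsRegular) (hθ : θ ∈ M.Θ) (W : Matrix (Fin n) (Fin n) ℝ) :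
    M.sldBound θ W = (W * (M.realFisher θ)⁻¹).trace := by
  have h : (M.sldFisher θ)⁻¹ = ((M.realFisher θ)⁻¹).map Complex.ofReal := by
    refine Matrix.inv_eq_right_inv ?_
    have h1 := congrArg (fun T : Matrix (Fin n) (Fin n) ℝ => T.map Complex.ofRealHom)
      (Matrix.mul_nonsing_inv _ (hreg.isUnit_det_realFisher hθ))
    rw [Matrix.map_mul, Matrix.map_one _ (map_zero _) (map_one _)] at h1
    rw [hreg.sldFisher_eq hθ]
    exact h1
  rw [sldBound, h]
  congr 2

lemma IsRegular.sum_realFisher_smul_dualSld (hreg : M.IsRegular) (hθ : θ ∈ M.Θ) (i : Fin n) :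
    ∑ j, M.realFisher θ i j • M.dualSld θ j = M.sld θ i := by
  simp only [dualSld, Finset.smul_sum, smul_smul]
  rw [Finset.sum_comm]
  simp only [← Finset.sum_smul, ← Matrix.mul_apply]
  rw [Matrix.mul_nonsing_inv _ (hreg.isUnit_det_realFisher hθ)]
  simp [Matrix.one_apply]

lemma IsRegular.sldTangent_le_span_dualSld (hreg : M.IsRegular) (hθ : θ ∈ M.Θ) :
    M.sldTangent θ ≤ Submodule.span ℝ (Set.range (M.dualSld θ)) := by
  refine Submodule.span_le.2 ?_
  rintro _ ⟨i, rfl⟩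
  rw [SetLike.mem_coe, ← hreg.sum_realFisher_smul_dualSld hθ i]
  exact Submodule.sum_mem _ fun j _ => Submodule.smul_mem _ _ (Submodule.subset_span ⟨j, rfl⟩)

lemma IsRegular.re_rldInner_sld_dualSld (hreg : M.IsRegular) (hθ : θ ∈ M.Θ) (i j : Fin n) :
    (rldInner (M.ρ θ) (M.sld θ i) (M.dualSld θ j)).re = if i = j then 1 else 0 := by
  have h1 : (rldForm (M.ρ θ) (M.sld θ i) (M.dualSld θ j)).re =
      ((M.realFisher θ)⁻¹ * M.realFisher θ) j i := by
    simp only [dualSld, map_sum, map_smul, Complex.re_sum, Complex.smul_re, smul_eq_mul,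
      Matrix.mul_apply, realFisher, Matrix.of_apply, rldForm_apply]
    exact Finset.sum_congr rfl fun k _ => by rw [re_rldInner_comm (M.posDef θ hθ)]
  rw [← rldForm_apply, h1, Matrix.nonsing_inv_mul _ (hreg.isUnit_det_realFisher hθ),
    Matrix.one_apply]
  simp only [eq_comm]

lemma IsRegular.re_rldInner_dualSld (hreg : M.IsRegular) (hθ : θ ∈ M.Θ) (i j : Fin n) :
    (rldInner (M.ρ θ) (M.dualSld θ i) (M.dualSld θ j)).re = (M.realFisher θ)⁻¹ i j := by
  have h1 : (rldForm (M.ρ θ) (M.dualSld θ i) (M.dualSld θ j)).re =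
      ∑ k, (M.realFisher θ)⁻¹ i k * (rldInner (M.ρ θ) (M.sld θ k) (M.dualSld θ j)).re := by
    conv_lhs => rw [dualSld]
    simp only [map_sum, map_smul, LinearMap.sum_apply, LinearMap.smul_apply, Complex.re_sum,
      Complex.smul_re, smul_eq_mul, rldForm_apply]
  rw [← rldForm_apply, h1]
  simp [hreg.re_rldInner_sld_dualSld hθ]

lemma IsRegular.dualSld_mem_holevoSet (hreg : M.IsRegular) (hθ : θ ∈ M.Θ) :
    M.dualSld θ ∈ M.holevoSet θ := by
  have hherm : ∀ i, (M.dualSld θ i).IsHermitian := fun i =>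
    hreg.isHermitian_of_mem_sldTangent hθ (dualSld_mem_sldTangent M θ i)
  refine ⟨hherm, fun i => ?_, fun i j => ?_⟩
  · simp only [dualSld, Finset.mul_sum, Matrix.trace_sum, Matrix.mul_smul, Matrix.trace_smul]
    refine Finset.sum_eq_zero fun j _ => ?_
    rw [sld, trace_mul_sldOp (M.posDef θ hθ), hreg.trace_partialDeriv hθ, smul_zero]
  · rw [hreg.trace_partialDeriv_mul hθ i (hherm j), hreg.re_rldInner_sld_dualSld hθ]
    split_ifs <;> simp

/-- A Hermitian operator annihilated by all derivatives of the state is orthogonal to the SLD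
tangent space with respect to the real part of the RLD inner product. -/
lemma IsRegular.re_rldInner_eq_zero (hreg : M.IsRegular) (hθ : θ ∈ M.Θ)
    {Y Z : Matrix (Fin d) (Fin d) ℂ} (hY : Y ∈ M.sldTangent θ) (hZ : Z.IsHermitian)
    (hAZ : ∀ i, (M.partialDeriv θ i * Z).trace = 0) : (rldInner (M.ρ θ) Y Z).re = 0 := by
  rw [← rldForm_apply]
  induction hY using Submodule.span_induction with
  | mem x hx =>
    obtain ⟨i, rfl⟩ := hx
    have h := hAZ i
    rw [hreg.trace_partialDeriv_mul hθ i hZ] at h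
    exact_mod_cast h
  | zero => simp
  | add x y _ _ hx hy => simp [hx, hy]
  | smul a x _ hx => simp [hx]

/-- Under D-invariance the orthogonality holds for the RLD inner product itself. -/
lemma IsRegular.rldInner_eq_zero (hreg : M.IsRegular) (hθ : θ ∈ M.Θ)
    (hD : ∀ X ∈ M.sldTangent θ, commOp (M.ρ θ) X ∈ M.sldTangent θ)
    {Y Z : Matrix (Fin d) (Fin d) ℂ} (hY : Y ∈ M.sldTangent θ) (hZ : Z.IsHermitian)
    (hAZ : ∀ i, (M.partialDeriv θ i * Z).trace = 0) : rldInner (M.ρ θ) Y Z = 0 := by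
  refine Complex.ext (hreg.re_rldInner_eq_zero hθ hY hZ hAZ) ?_
  rw [im_rldInner_eq_neg_re_commOp (M.posDef θ hθ) (hreg.isHermitian_of_mem_sldTangent hθ hY) hZ
    (hreg.isHermitian_of_mem_sldTangent hθ (hD Y hY)),
    hreg.re_rldInner_eq_zero hθ (hD Y hY) hZ hAZ, neg_zero, Complex.zero_im]

section Admissible

variable {X : Fin n → Matrix (Fin d) (Fin d) ℂ}

lemma IsRegular.isHermitian_sub_dualSld (hreg : M.IsRegular) (hθ : θ ∈ M.Θ)
    (hX : X ∈ M.holevoSet θ) (i : Fin n) : (X i - M.dualSld θ i).IsHermitian :=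
  (hX.1 i).sub ((hreg.dualSld_mem_holevoSet hθ).1 i)

lemma IsRegular.trace_partialDeriv_mul_sub_dualSld (hreg : M.IsRegular) (hθ : θ ∈ M.Θ)
    (hX : X ∈ M.holevoSet θ) (i j : Fin n) :
    (M.partialDeriv θ i * (X j - M.dualSld θ j)).trace = 0 := by
  rw [Matrix.mul_sub, Matrix.trace_sub, hX.2.2, (hreg.dualSld_mem_holevoSet hθ).2.2, sub_self]

lemma holevoMatrix_eq (M : QuantumModel n d) (θ : Fin n → ℝ) (i j : Fin n) :
    M.holevoMatrix θ X i j = M.holevoMatrix θ (M.dualSld θ) i j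
      + M.holevoMatrix θ (X - M.dualSld θ) i j
      + rldInner (M.ρ θ) (M.dualSld θ i) (X j - M.dualSld θ j)
      + rldInner (M.ρ θ) (X i - M.dualSld θ i) (M.dualSld θ j) := by
  simp only [holevoMatrix, Matrix.of_apply, Pi.sub_apply, ← rldForm_apply, map_sub,
    LinearMap.sub_apply]
  ring

lemma IsRegular.re_holevoMatrix (hreg : M.IsRegular) (hθ : θ ∈ M.Θ) (hX : X ∈ M.holevoSet θ) :
    (M.holevoMatrix θ X).map Complex.re =
      (M.realFisher θ)⁻¹ + (M.holevoMatrix θ (X - M.dualSld θ)).map Complex.re := by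
  ext i j
  have h1 := hreg.re_rldInner_eq_zero hθ (dualSld_mem_sldTangent M θ i)
    (hreg.isHermitian_sub_dualSld hθ hX j)
    fun k => hreg.trace_partialDeriv_mul_sub_dualSld hθ hX k j
  have h2 := hreg.re_rldInner_eq_zero hθ (dualSld_mem_sldTangent M θ j)
    (hreg.isHermitian_sub_dualSld hθ hX i)
    fun k => hreg.trace_partialDeriv_mul_sub_dualSld hθ hX k i
  rw [re_rldInner_comm (M.posDef θ hθ)] at h2
  rw [Matrix.map_apply, holevoMatrix_eq, Matrix.add_apply, Matrix.map_apply, Complex.add_re,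
    Complex.add_re, Complex.add_re, h1, h2, holevoMatrix, Matrix.of_apply,
    hreg.re_rldInner_dualSld hθ]
  ring

lemma IsRegular.im_holevoMatrix (hreg : M.IsRegular) (hθ : θ ∈ M.Θ)
    (hD : ∀ X ∈ M.sldTangent θ, commOp (M.ρ θ) X ∈ M.sldTangent θ)
    (hX : X ∈ M.holevoSet θ) (i j : Fin n) :
    (M.holevoMatrix θ X i j).im = (M.holevoMatrix θ (M.dualSld θ) i j).im +
      (M.holevoMatrix θ (X - M.dualSld θ) i j).im := by
  have h1 := hreg.rldInner_eq_zero hθ hD (dualSld_mem_sldTangent M θ i)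
    (hreg.isHermitian_sub_dualSld hθ hX j)
    fun k => hreg.trace_partialDeriv_mul_sub_dualSld hθ hX k j
  have h2 := hreg.rldInner_eq_zero hθ hD (dualSld_mem_sldTangent M θ j)
    (hreg.isHermitian_sub_dualSld hθ hX i)
    fun k => hreg.trace_partialDeriv_mul_sub_dualSld hθ hX k i
  rw [← rldInner_conj (M.posDef θ hθ), star_eq_zero] at h2
  rw [holevoMatrix_eq, h1, h2]
  simp

end Admissible

lemma re_holevoMatrix_posSemidef (hθ : θ ∈ M.Θ) (Z : Fin n → Matrix (Fin d) (Fin d) ℂ) :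
    ((M.holevoMatrix θ Z).map Complex.re).PosSemidef := by
  refine Matrix.PosSemidef.of_dotProduct_mulVec_nonneg ?_ fun v => ?_
  · ext i j
    simpa [holevoMatrix] using re_rldInner_comm (M.posDef θ hθ) (Z j) (Z i)
  · have hform : star v ⬝ᵥ (M.holevoMatrix θ Z).map Complex.re *ᵥ v =
        (rldForm (M.ρ θ) (∑ i, v i • Z i) (∑ i, v i • Z i)).re := by
      simp only [map_sum, map_smul, LinearMap.sum_apply, LinearMap.smul_apply, Complex.re_sum,
        Complex.smul_re, smul_eq_mul, dotProduct, Matrix.mulVec, holevoMatrix, Matrix.map_apply,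
        Matrix.of_apply, star_trivial, rldForm_apply, Finset.mul_sum]
      rw [Finset.sum_comm]
      refine Finset.sum_congr rfl fun i _ => Finset.sum_congr rfl fun j _ => ?_
      ring
    rw [hform]
    exact (Complex.nonneg_iff.1 (rldInner_self_nonneg (M.posDef θ hθ) _)).1

/-- The entries of the imaginary part of a Gram matrix are bounded by its trace. -/
lemma abs_im_holevoMatrix_le (hθ : θ ∈ M.Θ) (Z : Fin n → Matrix (Fin d) (Fin d) ℂ)
    (i j : Fin n) :
    |(M.holevoMatrix θ Z i j).im| ≤ ((M.holevoMatrix θ Z).map Complex.re).trace := by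
  have hnn : ∀ k, 0 ≤ (M.holevoMatrix θ Z k k).re := fun k =>
    (Complex.nonneg_iff.1 (rldInner_self_nonneg (M.posDef θ hθ) (Z k))).1
  have hle : ∀ k, (M.holevoMatrix θ Z k k).re ≤ ((M.holevoMatrix θ Z).map Complex.re).trace :=
    fun k => Finset.single_le_sum (f := fun k => (M.holevoMatrix θ Z k k).re)
      (fun k _ => hnn k) (Finset.mem_univ k)
  have h := abs_im_rldInner_le (M.posDef θ hθ) (Z i) (Z j)
  have hi := hle i
  have hj := hle j
  simp only [holevoMatrix, Matrix.of_apply] at hi hj ⊢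
  linarith

/-- The SLD Cramér–Rao bound is a lower bound of the Holevo function. -/
lemma IsRegular.sldBound_le_holevoFun (hreg : M.IsRegular) (hθ : θ ∈ M.Θ)
    {W : Matrix (Fin n) (Fin n) ℝ} (hW : W.PosDef) {X : Fin n → Matrix (Fin d) (Fin d) ℂ}
    (hX : X ∈ M.holevoSet θ) : M.sldBound θ W ≤ M.holevoFun θ X W := by
  rw [hreg.sldBound_eq hθ, holevoFun, hreg.re_holevoMatrix hθ hX, Matrix.mul_add, Matrix.trace_add]
  have h1 := trace_mul_nonneg hW.posSemidef
    (re_holevoMatrix_posSemidef hθ (X - M.dualSld θ))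
  have h2 := trace_cfcAbs_nonneg
    (CFC.sqrt W * (M.holevoMatrix θ X).map Complex.im * CFC.sqrt W)
  linarith

/-- If the dual SLD family has a real Gram matrix, then it attains the SLD bound. -/
lemma IsRegular.holevoBound_eq_sldBound (hreg : M.IsRegular) (hθ : θ ∈ M.Θ)
    (him : ∀ i j, (M.holevoMatrix θ (M.dualSld θ) i j).im = 0)
    {W : Matrix (Fin n) (Fin n) ℝ} (hW : W.PosDef) : M.holevoBound θ W = M.sldBound θ W := by
  have hval : M.holevoFun θ (M.dualSld θ) W = M.sldBound θ W := by
    have h1 : (M.holevoMatrix θ (M.dualSld θ)).map Complex.im = 0 := by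
      ext i j; exact him i j
    have h2 : (M.holevoMatrix θ (M.dualSld θ)).map Complex.re = (M.realFisher θ)⁻¹ := by
      ext i j; exact hreg.re_rldInner_dualSld hθ i j
    rw [holevoFun, h1, h2, hreg.sldBound_eq hθ]
    simp
  refine IsLeast.csInf_eq ⟨⟨_, hreg.dualSld_mem_holevoSet hθ, hval⟩, ?_⟩
  rintro _ ⟨X, hX, rfl⟩
  exact hreg.sldBound_le_holevoFun hθ hW hX

/-- Under D-invariance the gap between the Holevo function and the SLD bound, for the unit weight,
is bounded below by the imaginary parts of the Gram matrix of the dual SLD family: a correction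
orthogonal to the tangent space cannot cancel an imaginary part without paying as much in the
real part. -/
lemma IsRegular.sldBound_add_abs_le_holevoFun (hreg : M.IsRegular) (hθ : θ ∈ M.Θ)
    (hD : ∀ X ∈ M.sldTangent θ, commOp (M.ρ θ) X ∈ M.sldTangent θ)
    {X : Fin n → Matrix (Fin d) (Fin d) ℂ} (hX : X ∈ M.holevoSet θ) (i j : Fin n) :
    M.sldBound θ 1 + |(M.holevoMatrix θ (M.dualSld θ) i j).im| ≤ M.holevoFun θ X 1 := by
  rw [hreg.sldBound_eq hθ, holevoFun, hreg.re_holevoMatrix hθ hX, CFC.sqrt_one]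
  simp only [Matrix.one_mul, Matrix.mul_one, Matrix.trace_add]
  have h1 := abs_entry_le_trace_cfcAbs ((M.holevoMatrix θ X).map Complex.im) i j
  have h2 := abs_im_holevoMatrix_le hθ (X - M.dualSld θ) i j
  rw [Matrix.map_apply, hreg.im_holevoMatrix hθ hD hX] at h1
  have h3 := abs_sub_abs_le_abs_sub ((M.holevoMatrix θ (M.dualSld θ) i j).im)
    (-(M.holevoMatrix θ (X - M.dualSld θ) i j).im)
  rw [abs_neg, sub_neg_eq_add] at h3
  linarith

lemma IsRegular.im_holevoMatrix_dualSld_eq_zero (hreg : M.IsRegular) (hθ : θ ∈ M.Θ)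
    (hD : ∀ X ∈ M.sldTangent θ, commOp (M.ρ θ) X ∈ M.sldTangent θ)
    (hC : M.holevoBound θ 1 = M.sldBound θ 1) (i j : Fin n) :
    (M.holevoMatrix θ (M.dualSld θ) i j).im = 0 := by
  have h : M.sldBound θ 1 + |(M.holevoMatrix θ (M.dualSld θ) i j).im| ≤ M.holevoBound θ 1 := by
    refine le_csInf ⟨_, M.dualSld θ, hreg.dualSld_mem_holevoSet hθ, rfl⟩ ?_
    rintro _ ⟨X, hX, rfl⟩
    exact hreg.sldBound_add_abs_le_holevoFun hθ hD hX i j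
  rw [hC] at h
  exact abs_eq_zero.1 (le_antisymm (by linarith) (abs_nonneg _))

/-- If the tangent space is D-invariant and the RLD inner product is real on it, then the
commutation operator vanishes on it. -/
lemma IsRegular.commOp_eq_zero_of_im_eq_zero (hreg : M.IsRegular) (hθ : θ ∈ M.Θ)
    (hD : ∀ X ∈ M.sldTangent θ, commOp (M.ρ θ) X ∈ M.sldTangent θ)
    (him : ∀ i j, (M.holevoMatrix θ (M.dualSld θ) i j).im = 0)
    {Y : Matrix (Fin d) (Fin d) ℂ} (hY : Y ∈ M.sldTangent θ) : commOp (M.ρ θ) Y = 0 := by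
  have hρ := M.posDef θ hθ
  have hreal : ∀ Y ∈ M.sldTangent θ, ∀ Y' ∈ M.sldTangent θ, (rldForm (M.ρ θ) Y Y').im = 0 := by
    intro Y hY Y' hY'
    replace hY := hreg.sldTangent_le_span_dualSld hθ hY
    replace hY' := hreg.sldTangent_le_span_dualSld hθ hY'
    induction hY, hY' using Submodule.span_induction₂ with
    | mem_mem x y hx hy =>
      obtain ⟨i, rfl⟩ := hx
      obtain ⟨j, rfl⟩ := hy
      exact him i j
    | zero_left => simp
    | zero_right => simp
    | add_left x y z _ _ _ hx hy => simp [hx, hy]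
    | add_right x y z _ _ _ hx hy => simp [hx, hy]
    | smul_left a x y _ _ hx => simp [hx]
    | smul_right a x y _ _ hx => simp [hx]
  have h1 := im_rldInner_eq_neg_re_commOp hρ (hreg.isHermitian_of_mem_sldTangent hθ hY)
    (hreg.isHermitian_of_mem_sldTangent hθ (hD Y hY))
    (hreg.isHermitian_of_mem_sldTangent hθ (hD Y hY))
  rw [← rldForm_apply, hreal Y hY _ (hD Y hY)] at h1
  refine (rldInner_self_eq_zero hρ).1 (Complex.ext ?_ ?_)
  · rw [Complex.zero_re]; linarith
  · exact hreal _ (hD Y hY) _ (hD Y hY)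

end QuantumModel

open QuantumState in
theorem theorem3 {n d : ℕ} (M : QuantumModel n d) (hreg : M.IsRegular)
    (hconn : IsPreconnected M.Θ) :
    List.TFAE [
      M.IsClassical,
      ∀ θ ∈ M.Θ, ∀ X ∈ M.sldTangent θ, X * M.ρ θ - M.ρ θ * X = 0,
      ∀ θ ∈ M.Θ, ∀ X ∈ M.rldTangent θ, X * M.ρ θ - M.ρ θ * X = 0,
      ∀ θ ∈ M.Θ, M.sldFisher θ = M.rldFisher θ,
      ∀ θ ∈ M.Θ, ∀ i, M.sld θ i = M.rld θ i,
      ∀ θ ∈ M.Θ, ∀ X ∈ M.sldTangent θ, QuantumState.commOp (M.ρ θ) X = 0,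
      ∀ θ ∈ M.Θ, ∀ X ∈ M.rldTangent θ, QuantumState.commOp (M.ρ θ) X = 0,
      M.IsDInvariant ∧ M.IsAsymptoticallyClassical] ∧
    (M.IsClassical ↔ M.IsDInvariant ∧ M.IsAsymptoticallyClassical) := by
  refine (and_iff_left_of_imp fun h => h.out 0 7).2 ?_
  have h2 : (∀ θ ∈ M.Θ, ∀ X ∈ M.sldTangent θ, X * M.ρ θ - M.ρ θ * X = 0) ↔
      ∀ θ ∈ M.Θ, ∀ i, Commute (M.partialDeriv θ i) (M.ρ θ) :=
    forall₂_congr fun θ hθ => (commute_span_iff _ _).trans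
      (forall_congr' fun i => commute_sldOp_iff (M.posDef θ hθ))
  have h3 : (∀ θ ∈ M.Θ, ∀ X ∈ M.rldTangent θ, X * M.ρ θ - M.ρ θ * X = 0) ↔
      ∀ θ ∈ M.Θ, ∀ i, Commute (M.partialDeriv θ i) (M.ρ θ) :=
    forall₂_congr fun θ hθ => (commute_span_iff _ _).trans
      (forall_congr' fun i => commute_rldOp_iff (M.posDef θ hθ))
  have h5 : (∀ θ ∈ M.Θ, ∀ i, M.sld θ i = M.rld θ i) ↔
      ∀ θ ∈ M.Θ, ∀ i, Commute (M.partialDeriv θ i) (M.ρ θ) :=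
    forall₂_congr fun θ hθ => forall_congr' fun i => sldOp_eq_rldOp_iff (M.posDef θ hθ)
  have hD : ∀ θ ∈ M.Θ, ∀ X, commOp (M.ρ θ) X = 0 ↔ X * M.ρ θ - M.ρ θ * X = 0 :=
    fun θ hθ X => (commOp_eq_zero_iff (M.posDef θ hθ)).trans sub_eq_zero.symm
  tfae_have 1 ↔ 2 := by
    rw [h2, hreg.isClassical_iff_commute]
    exact ⟨fun h θ hθ i => hreg.commute_partialDeriv h hθ i,
      fun h θ hθ θ' hθ' => hreg.commute_of_isPreconnected hconn h hθ hθ'⟩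
  tfae_have 2 ↔ 3 := h2.trans h3.symm
  tfae_have 2 ↔ 5 := h2.trans h5.symm
  tfae_have 6 ↔ 2 := forall₂_congr fun θ hθ => forall₂_congr fun X _ => hD θ hθ X
  tfae_have 7 ↔ 3 := forall₂_congr fun θ hθ => forall₂_congr fun X _ => hD θ hθ X
  tfae_have 5 → 4 := by
    intro h θ hθ
    ext i j
    have hc := (commute_sldOp_iff (M.posDef θ hθ)).2 (h5.1 h θ hθ j)
    change sldInner _ _ _ = rldInner _ _ _
    rw [← h θ hθ i, ← h θ hθ j]
    exact sldInner_eq_rldInner_of_commute hc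
  tfae_have 4 → 5 := by
    intro h θ hθ i
    have hd := rldInner_sub_sldInner_self (M.posDef θ hθ) (hreg.partialDeriv_isHermitian hθ i)
    have hii : sldInner _ _ _ = rldInner _ _ _ := congrFun (congrFun (h θ hθ) i) i
    rw [QuantumModel.sld, QuantumModel.rld] at hii
    rw [hii, sub_self, eq_comm, rldInner_self_eq_zero (M.posDef θ hθ), sub_eq_zero] at hd
    exact hd.symm
  tfae_have 6 → 8 := by
    intro h
    refine ⟨fun θ hθ X hX => ?_, fun θ hθ W hW => ?_⟩
    · rw [h θ hθ X hX]
      exact Submodule.zero_mem _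
    · refine hreg.holevoBound_eq_sldBound hθ (fun i j => ?_) hW
      have hX : ∀ i, M.dualSld θ i ∈ M.sldTangent θ := M.dualSld_mem_sldTangent θ
      have hH : ∀ i, (M.dualSld θ i).IsHermitian :=
        fun i => hreg.isHermitian_of_mem_sldTangent hθ (hX i)
      rw [QuantumModel.holevoMatrix, Matrix.of_apply,
        im_rldInner_eq_neg_re_commOp (M.posDef θ hθ) (hH i) (hH j), h θ hθ _ (hX i)]
      · simp [rldInner]
      · rw [h θ hθ _ (hX i)]
        exact Matrix.isHermitian_zero
  tfae_have 8 → 6 := by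
    rintro ⟨hDinv, hAC⟩ θ hθ X hX
    exact hreg.commOp_eq_zero_of_im_eq_zero hθ (hDinv θ hθ)
      (hreg.im_holevoMatrix_dualSld_eq_zero hθ (hDinv θ hθ) (hAC θ hθ 1 Matrix.PosDef.one)) hX
  tfae_finish
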